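/- Let $H$ be a fixed self-adjoint $n\times n$ matrix with real or complex entries. Then the real-valued map $$A \longmapsto \operatorname{tr}\exp(H + \log A)$$ is concave on the (convex) cone of positive-definite self-adjoint $n\times n$ matrices $A$ with entries in the same field. Here $\exp$ is the matrix exponential and $\log A$ is the matrix logarithm of the positive-definite matrix $A$, defined by applying the real logarithm to the eigenvalues of $A$ while keeping its eigenvectors. -/

import Mathlib

open scoped ComplexOrder

/-- The logarithm of a self-adjoint matrix, through the spectral functional calculus:
apply `Real.log` to the eigenvalues and keep the eigenvectors. -/
noncomputable def matrixLog {𝕜 : Type*} [RCLike 𝕜] {n : Type*} [Fintype n] [DecidableEq n]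
    (A : Matrix n n 𝕜) : Matrix n n 𝕜 :=
  cfc Real.log A

/-- The trace function `A ↦ tr exp (H + log A)` as a real number. For self-adjoint `H` the trace
is real, see `coe_liebTrace`, so that taking the real part loses nothing. -/
noncomputable def liebTrace {𝕜 : Type*} [RCLike 𝕜] {n : Type*} [Fintype n] [DecidableEq n]
    (H A : Matrix n n 𝕜) : ℝ :=
  RCLike.re (NormedSpace.exp (H + matrixLog A)).trace

theorem coe_liebTrace {𝕜 : Type*} [RCLike 𝕜] {n : Type*} [Fintype n] [DecidableEq n]
    {H : Matrix n n 𝕜} (hH : H.IsHermitian) (A : Matrix n n 𝕜) :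
    ((liebTrace H A : ℝ) : 𝕜) = (NormedSpace.exp (H + matrixLog A)).trace := by
  have hlog : (matrixLog A).IsHermitian := cfc_predicate Real.log A
  have h : (NormedSpace.exp (H + matrixLog A)).IsHermitian := (hH.add hlog).exp
  have h2 : star (NormedSpace.exp (H + matrixLog A)).trace
      = (NormedSpace.exp (H + matrixLog A)).trace := by
    rw [← Matrix.trace_conjTranspose, h.eq]
  exact RCLike.conj_eq_iff_re.mp h2

open Matrix

/-! ### Relative entropy and its joint convexity. -/

section RelativeEntropy

variable {𝕜 : Type*} [RCLike 𝕜] {n : Type*} [Fintype n] [DecidableEq n]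

/-! By the Gibbs variational principle, `tr exp (H + log A)` is the maximum over positive definite
`X` of `tr XH + tr A - D(X‖A)`, with `D` the relative entropy (`gibbsFunctional_le_liebTrace`,
`gibbsFunctional_exp`). Partial maximisation of a jointly concave function is concave, so joint
convexity of `D` suffices. For that, `D` is an integral of quadratic entropies with weight `t ≥ 0`
(`relEntropy_eq_integral`), each a maximum over `Z` of functions linear in `(X, Y)`, hence convex.
-/

theorem Matrix.IsHermitian.cfc_eq_mul_diagonal_mul {A : Matrix n n 𝕜} (hA : A.IsHermitian)
    (f : ℝ → ℝ) :
    cfc f A = (hA.eigenvectorUnitary : Matrix n n 𝕜)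
      * diagonal (fun i => ((f (hA.eigenvalues i) : ℝ) : 𝕜))
      * (hA.eigenvectorUnitary : Matrix n n 𝕜)ᴴ := by
  rw [hA.cfc_eq, IsHermitian.cfc, Unitary.conjStarAlgAut_apply]
  rfl

/-- The matrix of `Z` with respect to the eigenbases of `X` and `Y`. -/
noncomputable def mixedBasis {X Y : Matrix n n 𝕜} (hX : X.IsHermitian) (hY : Y.IsHermitian)
    (Z : Matrix n n 𝕜) : Matrix n n 𝕜 :=
  (hX.eigenvectorUnitary : Matrix n n 𝕜)ᴴ * Z * (hY.eigenvectorUnitary : Matrix n n 𝕜)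

theorem mixedBasis_surjective {X Y : Matrix n n 𝕜} (hX : X.IsHermitian) (hY : Y.IsHermitian) :
    Function.Surjective (mixedBasis hX hY) := by
  intro W
  have h1 : (hX.eigenvectorUnitary : Matrix n n 𝕜)ᴴ * (hX.eigenvectorUnitary : Matrix n n 𝕜) = 1 :=
    Unitary.coe_star_mul_self _
  have h2 : (hY.eigenvectorUnitary : Matrix n n 𝕜)ᴴ * (hY.eigenvectorUnitary : Matrix n n 𝕜) = 1 :=
    Unitary.coe_star_mul_self _
  refine ⟨(hX.eigenvectorUnitary : Matrix n n 𝕜) * W * (hY.eigenvectorUnitary : Matrix n n 𝕜)ᴴ, ?_⟩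
  calc _ = ((hX.eigenvectorUnitary : Matrix n n 𝕜)ᴴ * (hX.eigenvectorUnitary : Matrix n n 𝕜)) * W
        * ((hY.eigenvectorUnitary : Matrix n n 𝕜)ᴴ * (hY.eigenvectorUnitary : Matrix n n 𝕜)) := by
        simp only [mixedBasis, Matrix.mul_assoc]
    _ = W := by rw [h1, h2, Matrix.one_mul, Matrix.mul_one]

/-- Left multiplication by `f(X)` and right multiplication by `g(Y)` are simultaneously diagonal in
the mixed eigenbasis, which reduces trace identities to scalar ones. -/
theorem trace_conjTranspose_mul_cfc_mul_cfc {X Y : Matrix n n 𝕜} (hX : X.IsHermitian)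
    (hY : Y.IsHermitian) (Z Z' : Matrix n n 𝕜) (f g : ℝ → ℝ) :
    RCLike.re (Zᴴ * cfc f X * Z' * cfc g Y).trace = ∑ i, ∑ j,
      f (hX.eigenvalues i) * g (hY.eigenvalues j)
        * RCLike.re (star (mixedBasis hX hY Z i j) * mixedBasis hX hY Z' i j) := by
  have key : (Zᴴ * cfc f X * Z' * cfc g Y).trace =
      ((mixedBasis hX hY Z)ᴴ * diagonal (fun i => ((f (hX.eigenvalues i) : ℝ) : 𝕜))
        * (mixedBasis hX hY Z' * diagonal (fun i => ((g (hY.eigenvalues i) : ℝ) : 𝕜)))).trace := by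
    rw [hX.cfc_eq_mul_diagonal_mul, hY.cfc_eq_mul_diagonal_mul, ← Matrix.mul_assoc,
      Matrix.trace_mul_comm]
    simp only [mixedBasis, conjTranspose_mul, conjTranspose_conjTranspose, Matrix.mul_assoc]
  rw [key, Matrix.trace, map_sum, Finset.sum_comm]
  refine Finset.sum_congr rfl fun j _ => ?_
  rw [diag_apply, Matrix.mul_apply, map_sum]
  refine Finset.sum_congr rfl fun i _ => ?_
  rw [mul_diagonal, mul_diagonal, conjTranspose_apply, ← RCLike.re_ofReal_mul]
  congr 1
  push_cast
  ring

theorem re_trace_mul_cfc {X Y : Matrix n n 𝕜} (hX : X.IsHermitian)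
    (hY : Y.IsHermitian) (f g : ℝ → ℝ) :
    RCLike.re (cfc f X * cfc g Y).trace = ∑ i, ∑ j,
      f (hX.eigenvalues i) * g (hY.eigenvalues j) * ‖mixedBasis hX hY 1 i j‖ ^ 2 := by
  have h := trace_conjTranspose_mul_cfc_mul_cfc hX hY 1 1 f g
  rw [conjTranspose_one, Matrix.one_mul, Matrix.mul_one] at h
  rw [h]
  simp only [RCLike.star_def, RCLike.conj_mul, ← RCLike.ofReal_pow, RCLike.ofReal_re]

/-- The Umegaki relative entropy of unnormalised density matrices. -/
noncomputable def relEntropy (X Y : Matrix n n 𝕜) : ℝ :=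
  RCLike.re (X * (matrixLog X - matrixLog Y) - X + Y).trace

theorem cfc_self_of_isHermitian {X : Matrix n n 𝕜} (hX : X.IsHermitian) :
    cfc (fun x : ℝ => x) X = X := cfc_id' ℝ X hX

theorem cfc_one_of_isHermitian {X : Matrix n n 𝕜} (hX : X.IsHermitian) :
    cfc (fun _ : ℝ => (1 : ℝ)) X = 1 := cfc_const_one ℝ X hX

theorem mul_matrixLog_self {X : Matrix n n 𝕜} (hX : X.IsHermitian) :
    X * matrixLog X = cfc (fun x : ℝ => x * Real.log x) X := by
  have hc (f : ℝ → ℝ) : ContinuousOn f (spectrum ℝ X) :=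
    (Matrix.finite_real_spectrum (A := X)).continuousOn f
  rw [cfc_mul (fun x : ℝ => x) Real.log X (hc _) (hc _), cfc_self_of_isHermitian hX, matrixLog]

theorem relEntropy_eq_sum {X Y : Matrix n n 𝕜} (hX : X.IsHermitian) (hY : Y.IsHermitian) :
    relEntropy X Y = ∑ i, ∑ j,
      (hX.eigenvalues i * (Real.log (hX.eigenvalues i) - Real.log (hY.eigenvalues j))
        - hX.eigenvalues i + hY.eigenvalues j) * ‖mixedBasis hX hY 1 i j‖ ^ 2 := by
  have h1 := re_trace_mul_cfc hX hY (fun x => x * Real.log x) (fun _ => 1)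
  have h2 := re_trace_mul_cfc hX hY (fun x => x) Real.log
  have h3 := re_trace_mul_cfc hX hY (fun x => x) (fun _ => 1)
  have h4 := re_trace_mul_cfc hX hY (fun _ => 1) (fun x => x)
  rw [cfc_one_of_isHermitian hY, Matrix.mul_one, ← mul_matrixLog_self hX] at h1
  rw [cfc_self_of_isHermitian hX] at h2
  rw [cfc_one_of_isHermitian hY, Matrix.mul_one, cfc_self_of_isHermitian hX] at h3
  rw [cfc_one_of_isHermitian hX, Matrix.one_mul, cfc_self_of_isHermitian hY] at h4
  rw [relEntropy, Matrix.mul_sub, trace_add, trace_sub, trace_sub, map_add, map_sub, map_sub,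
    h1, h3, h4, matrixLog, h2]
  simp only [← Finset.sum_sub_distrib, ← Finset.sum_add_distrib]
  refine Finset.sum_congr rfl fun i _ => Finset.sum_congr rfl fun j _ => ?_
  ring

/-- The quasi-entropy of `(x - y) ^ 2 / ((1 - t) * x + t * y)`. -/
noncomputable def quadEntropy {X Y : Matrix n n 𝕜} (hX : X.IsHermitian) (hY : Y.IsHermitian)
    (t : ℝ) : ℝ :=
  ∑ i, ∑ j, (hX.eigenvalues i - hY.eigenvalues j) ^ 2
    / ((1 - t) * hX.eigenvalues i + t * hY.eigenvalues j) * ‖mixedBasis hX hY 1 i j‖ ^ 2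

theorem convexCombination_pos {x y t : ℝ} (hx : 0 < x) (hy : 0 < y) (ht : t ∈ Set.Icc (0 : ℝ) 1) :
    0 < (1 - t) * x + t * y :=
  (convex_Ioi (0 : ℝ)) hx hy (sub_nonneg.2 ht.2) ht.1 (by ring)

theorem continuousOn_mul_sq_sub_div {x y : ℝ} (hx : 0 < x) (hy : 0 < y) :
    ContinuousOn (fun t : ℝ => t * ((x - y) ^ 2 / ((1 - t) * x + t * y))) (Set.Icc 0 1) := by
  refine continuousOn_id.mul (continuousOn_const.div (by fun_prop) fun t ht => ?_)
  exact (convexCombination_pos hx hy ht).ne'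

theorem integral_mul_sq_sub_div {x y : ℝ} (hx : 0 < x) (hy : 0 < y) :
    ∫ t in (0 : ℝ)..1, t * ((x - y) ^ 2 / ((1 - t) * x + t * y))
      = x * (Real.log x - Real.log y) - x + y := by
  have hI : Set.uIcc (0 : ℝ) 1 = Set.Icc 0 1 := Set.uIcc_of_le zero_le_one
  -- With `p = x + t(y - x)`, the integrand is `(y - x)(p - x)/p = (y - x) - x(y - x)/p`.
  have hderiv : ∀ t ∈ Set.uIcc (0 : ℝ) 1,
      HasDerivAt (fun t : ℝ => t * (y - x) - x * Real.log ((1 - t) * x + t * y))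
        (t * ((x - y) ^ 2 / ((1 - t) * x + t * y))) t := by
    intro t ht
    have hp := convexCombination_pos hx hy (hI ▸ ht)
    have h1 : HasDerivAt (fun t : ℝ => (1 - t) * x + t * y) (-1 * x + 1 * y) t :=
      (((hasDerivAt_id t).const_sub 1).mul_const x).add ((hasDerivAt_id t).mul_const y)
    refine (((hasDerivAt_id t).mul_const (y - x)).sub
      ((h1.log hp.ne').const_mul x)).congr_deriv (Eq.symm ?_)
    rw [one_mul, one_mul, neg_one_mul, mul_div_assoc', eq_sub_iff_add_eq, mul_div_assoc', ← add_div,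
      div_eq_iff hp.ne']
    ring
  rw [intervalIntegral.integral_eq_sub_of_hasDerivAt hderiv]
  · simp
    ring
  · exact (hI ▸ continuousOn_mul_sq_sub_div hx hy).intervalIntegrable

theorem continuousOn_mul_quadEntropy {X Y : Matrix n n 𝕜} (hX : X.PosDef) (hY : Y.PosDef) :
    ContinuousOn (fun t => t * quadEntropy hX.1 hY.1 t) (Set.Icc 0 1) := by
  simp only [quadEntropy, Finset.mul_sum, ← mul_assoc]
  refine continuousOn_finsetSum _ fun i _ => continuousOn_finsetSum _ fun j _ => ?_
  exact (continuousOn_mul_sq_sub_div (hX.eigenvalues_pos i) (hY.eigenvalues_pos j)).mul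
    continuousOn_const

theorem intervalIntegrable_mul_quadEntropy {X Y : Matrix n n 𝕜} (hX : X.PosDef) (hY : Y.PosDef) :
    IntervalIntegrable (fun t => t * quadEntropy hX.1 hY.1 t) MeasureTheory.volume 0 1 := by
  refine ContinuousOn.intervalIntegrable ?_
  rw [Set.uIcc_of_le zero_le_one]
  exact continuousOn_mul_quadEntropy hX hY

theorem relEntropy_eq_integral {X Y : Matrix n n 𝕜} (hX : X.PosDef) (hY : Y.PosDef) :
    relEntropy X Y = ∫ t in (0 : ℝ)..1, t * quadEntropy hX.1 hY.1 t := by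
  have hint (i j : n) : IntervalIntegrable (fun t : ℝ =>
      t * ((hX.1.eigenvalues i - hY.1.eigenvalues j) ^ 2
        / ((1 - t) * hX.1.eigenvalues i + t * hY.1.eigenvalues j))
        * ‖mixedBasis hX.1 hY.1 1 i j‖ ^ 2) MeasureTheory.volume 0 1 := by
    refine ContinuousOn.intervalIntegrable ?_
    rw [Set.uIcc_of_le zero_le_one]
    exact (continuousOn_mul_sq_sub_div (hX.eigenvalues_pos i) (hY.eigenvalues_pos j)).mul
      continuousOn_const
  have hsum (i : n) : IntervalIntegrable (fun t : ℝ => ∑ j,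
      t * ((hX.1.eigenvalues i - hY.1.eigenvalues j) ^ 2
        / ((1 - t) * hX.1.eigenvalues i + t * hY.1.eigenvalues j))
        * ‖mixedBasis hX.1 hY.1 1 i j‖ ^ 2) MeasureTheory.volume 0 1 := by
    simpa only [Finset.sum_fn] using IntervalIntegrable.sum Finset.univ fun j _ => hint i j
  simp only [quadEntropy, Finset.mul_sum, ← mul_assoc]
  rw [relEntropy_eq_sum hX.1 hY.1, intervalIntegral.integral_finsetSum
    fun i _ => hsum i]
  refine Finset.sum_congr rfl fun i _ => ?_
  rw [intervalIntegral.integral_finsetSum fun j _ => hint i j]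
  refine Finset.sum_congr rfl fun j _ => ?_
  rw [intervalIntegral.integral_mul_const,
    integral_mul_sq_sub_div (hX.eigenvalues_pos i) (hY.eigenvalues_pos j)]

theorem quadEntropy_nonneg {X Y : Matrix n n 𝕜} (hX : X.PosDef) (hY : Y.PosDef) {t : ℝ}
    (ht : t ∈ Set.Icc (0 : ℝ) 1) : 0 ≤ quadEntropy hX.1 hY.1 t := by
  refine Finset.sum_nonneg fun i _ => Finset.sum_nonneg fun j _ => ?_
  have := convexCombination_pos (hX.eigenvalues_pos i) (hY.eigenvalues_pos j) ht
  positivity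

/-- **Klein's inequality** for the relative entropy. -/
theorem relEntropy_nonneg {X Y : Matrix n n 𝕜} (hX : X.PosDef) (hY : Y.PosDef) :
    0 ≤ relEntropy X Y := by
  rw [relEntropy_eq_integral hX hY]
  exact intervalIntegral.integral_nonneg zero_le_one fun t ht =>
    mul_nonneg ht.1 (quadEntropy_nonneg hX hY ht)

/-- The affine function of `(X, Y)` whose supremum over `Z` is `quadEntropy`. -/
noncomputable def quadDual (t : ℝ) (Z X Y : Matrix n n 𝕜) : ℝ :=
  2 * RCLike.re (Zᴴ * (X - Y)).trace - (1 - t) * RCLike.re (Zᴴ * X * Z).trace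
    - t * RCLike.re (Zᴴ * Z * Y).trace

theorem quadDual_eq_sum {X Y : Matrix n n 𝕜} (hX : X.IsHermitian) (hY : Y.IsHermitian)
    (t : ℝ) (Z : Matrix n n 𝕜) :
    quadDual t Z X Y = ∑ i, ∑ j,
      (2 * (hX.eigenvalues i - hY.eigenvalues j)
          * RCLike.re (star (mixedBasis hX hY Z i j) * mixedBasis hX hY 1 i j)
        - ((1 - t) * hX.eigenvalues i + t * hY.eigenvalues j) * ‖mixedBasis hX hY Z i j‖ ^ 2) := by
  have h1 := trace_conjTranspose_mul_cfc_mul_cfc hX hY Z 1 (fun x => x) (fun _ => 1)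
  have h2 := trace_conjTranspose_mul_cfc_mul_cfc hX hY Z 1 (fun _ => 1) (fun x => x)
  have h3 := trace_conjTranspose_mul_cfc_mul_cfc hX hY Z Z (fun x => x) (fun _ => 1)
  have h4 := trace_conjTranspose_mul_cfc_mul_cfc hX hY Z Z (fun _ => 1) (fun x => x)
  simp only [cfc_one_of_isHermitian hX, cfc_one_of_isHermitian hY, cfc_self_of_isHermitian hX,
    cfc_self_of_isHermitian hY, one_mul, mul_one] at h1 h2 h3 h4
  rw [quadDual, Matrix.mul_sub, trace_sub, map_sub, h1, h2, h3, h4]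
  simp only [Finset.mul_sum, ← Finset.sum_sub_distrib]
  refine Finset.sum_congr rfl fun i _ => Finset.sum_congr rfl fun j _ => ?_
  have hn : RCLike.re (star (mixedBasis hX hY Z i j) * mixedBasis hX hY Z i j)
      = ‖mixedBasis hX hY Z i j‖ ^ 2 := by
    rw [RCLike.star_def, RCLike.conj_mul, ← RCLike.ofReal_pow, RCLike.ofReal_re]
  rw [hn]
  ring

theorem quadDual_le_quadEntropy {X Y : Matrix n n 𝕜} (hX : X.PosDef) (hY : Y.PosDef) {t : ℝ}
    (ht : t ∈ Set.Icc (0 : ℝ) 1) (Z : Matrix n n 𝕜) :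
    quadDual t Z X Y ≤ quadEntropy hX.1 hY.1 t := by
  rw [quadDual_eq_sum hX.1 hY.1]
  refine Finset.sum_le_sum fun i _ => Finset.sum_le_sum fun j _ => ?_
  have hp := convexCombination_pos (hX.eigenvalues_pos i) (hY.eigenvalues_pos j) ht
  set p := (1 - t) * hX.1.eigenvalues i + t * hY.1.eigenvalues j
  set d := hX.1.eigenvalues i - hY.1.eigenvalues j
  set w := mixedBasis hX.1 hY.1 Z i j
  set c := mixedBasis hX.1 hY.1 1 i j
  have hre : d * RCLike.re (star w * c) ≤ |d| * (‖w‖ * ‖c‖) := by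
    refine (le_abs_self _).trans ?_
    rw [abs_mul]
    refine mul_le_mul_of_nonneg_left ((RCLike.abs_re_le_norm _).trans ?_) (abs_nonneg d)
    rw [norm_mul, norm_star]
  -- Completing the square, entry by entry.
  have hsq : 0 ≤ (p * ‖w‖ - |d| * ‖c‖) ^ 2 / p := by positivity
  have he : (p * ‖w‖ - |d| * ‖c‖) ^ 2 / p
      = p * ‖w‖ ^ 2 - 2 * (|d| * (‖w‖ * ‖c‖)) + d ^ 2 / p * ‖c‖ ^ 2 := by
    rw [← sq_abs d]
    field_simp
    ring
  linarith

theorem exists_quadDual_eq_quadEntropy {X Y : Matrix n n 𝕜} (hX : X.PosDef) (hY : Y.PosDef) {t : ℝ}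
    (ht : t ∈ Set.Icc (0 : ℝ) 1) :
    ∃ Z, quadDual t Z X Y = quadEntropy hX.1 hY.1 t := by
  -- Equality in the completed square: `w = (d / p) c` in every entry.
  obtain ⟨Z, hZ⟩ := mixedBasis_surjective hX.1 hY.1 (Matrix.of fun i j =>
    (((hX.1.eigenvalues i - hY.1.eigenvalues j)
      / ((1 - t) * hX.1.eigenvalues i + t * hY.1.eigenvalues j) : ℝ) : 𝕜)
        * mixedBasis hX.1 hY.1 1 i j)
  refine ⟨Z, ?_⟩
  rw [quadDual_eq_sum hX.1 hY.1, hZ]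
  refine Finset.sum_congr rfl fun i _ => Finset.sum_congr rfl fun j _ => ?_
  have hp := convexCombination_pos (hX.eigenvalues_pos i) (hY.eigenvalues_pos j) ht
  rw [Matrix.of_apply]
  set p := (1 - t) * hX.1.eigenvalues i + t * hY.1.eigenvalues j
  set d := hX.1.eigenvalues i - hY.1.eigenvalues j
  set c := mixedBasis hX.1 hY.1 1 i j
  have hre : RCLike.re (star (((d / p : ℝ) : 𝕜) * c) * c) = d / p * ‖c‖ ^ 2 := by
    rw [star_mul', RCLike.star_def, RCLike.conj_ofReal, mul_assoc, RCLike.re_ofReal_mul,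
      RCLike.conj_mul, ← RCLike.ofReal_pow, RCLike.ofReal_re]
  rw [hre, norm_mul, RCLike.norm_ofReal, mul_pow, sq_abs]
  field_simp
  ring

omit [DecidableEq n] in
theorem quadDual_add_smul (t : ℝ) (Z X₁ X₂ Y₁ Y₂ : Matrix n n 𝕜) (a b : ℝ) :
    quadDual t Z (a • X₁ + b • X₂) (a • Y₁ + b • Y₂)
      = a * quadDual t Z X₁ Y₁ + b * quadDual t Z X₂ Y₂ := by
  simp only [quadDual, Matrix.mul_sub, Matrix.mul_add, Matrix.add_mul, Matrix.mul_smul,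
    Matrix.smul_mul, trace_sub, trace_add, trace_smul, map_sub, map_add, RCLike.smul_re]
  ring

omit [Fintype n] [DecidableEq n] in
theorem Matrix.PosDef.convexCombination {X₁ X₂ : Matrix n n 𝕜} (h₁ : X₁.PosDef) (h₂ : X₂.PosDef)
    {a b : ℝ} (ha : 0 ≤ a) (hb : 0 ≤ b) (hab : a + b = 1) : (a • X₁ + b • X₂).PosDef := by
  rcases ha.eq_or_lt with rfl | ha
  · obtain rfl : b = 1 := by linarith
    simpa using h₂
  · exact (h₁.smul ha).add_posSemidef (h₂.posSemidef.smul hb)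

/-- **Joint convexity of the relative entropy** (Lindblad). -/
theorem relEntropy_jointly_convex {X₁ X₂ Y₁ Y₂ : Matrix n n 𝕜} (hX₁ : X₁.PosDef) (hX₂ : X₂.PosDef)
    (hY₁ : Y₁.PosDef) (hY₂ : Y₂.PosDef) {a b : ℝ} (ha : 0 ≤ a) (hb : 0 ≤ b) (hab : a + b = 1) :
    relEntropy (a • X₁ + b • X₂) (a • Y₁ + b • Y₂)
      ≤ a * relEntropy X₁ Y₁ + b * relEntropy X₂ Y₂ := by
  have hX := hX₁.convexCombination hX₂ ha hb hab
  have hY := hY₁.convexCombination hY₂ ha hb hab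
  have i₁ := (intervalIntegrable_mul_quadEntropy hX₁ hY₁).const_mul a
  have i₂ := (intervalIntegrable_mul_quadEntropy hX₂ hY₂).const_mul b
  rw [relEntropy_eq_integral hX hY, relEntropy_eq_integral hX₁ hY₁, relEntropy_eq_integral hX₂ hY₂,
    ← intervalIntegral.integral_const_mul, ← intervalIntegral.integral_const_mul,
    ← intervalIntegral.integral_add i₁ i₂]
  refine intervalIntegral.integral_mono_on zero_le_one (intervalIntegrable_mul_quadEntropy hX hY)
    (i₁.add i₂) fun t ht => ?_
  -- The `Z` optimal for the combination is merely a competitor at the two endpoints.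
  obtain ⟨Z, hZ⟩ := exists_quadDual_eq_quadEntropy hX hY ht
  have h₁ := mul_le_mul_of_nonneg_left (quadDual_le_quadEntropy hX₁ hY₁ ht Z) ha
  have h₂ := mul_le_mul_of_nonneg_left (quadDual_le_quadEntropy hX₂ hY₂ ht Z) hb
  rw [← hZ, quadDual_add_smul]
  calc _ ≤ t * (a * quadEntropy hX₁.1 hY₁.1 t + b * quadEntropy hX₂.1 hY₂.1 t) :=
        mul_le_mul_of_nonneg_left (add_le_add h₁ h₂) ht.1
    _ = _ := by ring

end RelativeEntropy

/-! ### The Gibbs variational principle. -/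

section Variational

variable {𝕜 : Type*} [RCLike 𝕜] {n : Type*} [Fintype n] [DecidableEq n]

theorem isHermitian_matrixLog (A : Matrix n n 𝕜) : (matrixLog A).IsHermitian :=
  cfc_predicate Real.log A

open scoped Matrix.Norms.L2Operator in
theorem matrixLog_exp {B : Matrix n n 𝕜} (hB : B.IsHermitian) :
    matrixLog (NormedSpace.exp B) = B :=
  let _ : NormedAlgebra ℝ (Matrix n n 𝕜) :=
    { norm_smul_le := fun r A => by
        rw [← algebraMap_smul 𝕜 r A, norm_smul, norm_algebraMap'] }
  CFC.log_exp B hB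

/-- The exponential is the square of the Hermitian matrix `exp (B / 2)`, and it is invertible. -/
theorem Matrix.IsHermitian.posDef_exp {B : Matrix n n 𝕜} (hB : B.IsHermitian) :
    (NormedSpace.exp B).PosDef := by
  have hC : ((2⁻¹ : ℝ) • B).IsHermitian := by
    rw [IsHermitian, conjTranspose_smul, hB.eq, star_trivial]
  have h : NormedSpace.exp B
      = (NormedSpace.exp ((2⁻¹ : ℝ) • B))ᴴ * NormedSpace.exp ((2⁻¹ : ℝ) • B) := by
    rw [hC.exp.eq, ← Matrix.exp_add_of_commute _ _ (Commute.refl _), ← add_smul]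
    norm_num
  have hs : (NormedSpace.exp B).PosSemidef := h ▸ posSemidef_conjTranspose_mul_self _
  exact hs.posDef_iff_isUnit.2 (Matrix.isUnit_exp B)

/-- The functional whose maximum over `X` is `liebTrace H A`. -/
noncomputable def gibbsFunctional (H X A : Matrix n n 𝕜) : ℝ :=
  RCLike.re (X * H).trace + RCLike.re A.trace - relEntropy X A

/-- The gap is exactly `D(X‖exp (H + log A))`, nonnegative by Klein's inequality. -/
theorem gibbsFunctional_le_liebTrace {H X A : Matrix n n 𝕜} (hH : H.IsHermitian) (hX : X.PosDef) :
    gibbsFunctional H X A ≤ liebTrace H A := by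
  have hB := hH.add (isHermitian_matrixLog A)
  have h := relEntropy_nonneg hX hB.posDef_exp
  rw [relEntropy, matrixLog_exp hB] at h
  rw [gibbsFunctional, liebTrace, relEntropy]
  simp only [Matrix.mul_sub, Matrix.mul_add, trace_add, trace_sub, map_add, map_sub] at h ⊢
  linarith

theorem gibbsFunctional_exp {H : Matrix n n 𝕜} (hH : H.IsHermitian) (A : Matrix n n 𝕜) :
    gibbsFunctional H (NormedSpace.exp (H + matrixLog A)) A = liebTrace H A := by
  rw [gibbsFunctional, liebTrace, relEntropy, matrixLog_exp (hH.add (isHermitian_matrixLog A)),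
    add_sub_cancel_right]
  simp only [trace_add, trace_sub, map_add, map_sub]
  ring

theorem gibbsFunctional_jointly_concave (H : Matrix n n 𝕜) {X₁ X₂ A₁ A₂ : Matrix n n 𝕜}
    (hX₁ : X₁.PosDef) (hX₂ : X₂.PosDef) (hA₁ : A₁.PosDef) (hA₂ : A₂.PosDef) {a b : ℝ}
    (ha : 0 ≤ a) (hb : 0 ≤ b) (hab : a + b = 1) :
    a * gibbsFunctional H X₁ A₁ + b * gibbsFunctional H X₂ A₂
      ≤ gibbsFunctional H (a • X₁ + b • X₂) (a • A₁ + b • A₂) := by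
  have h := relEntropy_jointly_convex hX₁ hX₂ hA₁ hA₂ ha hb hab
  simp only [gibbsFunctional, Matrix.add_mul, Matrix.smul_mul, trace_add, trace_smul, map_add,
    RCLike.smul_re]
  linarith

end Variational

theorem theorem1 {𝕜 : Type*} [RCLike 𝕜] {n : Type*} [Fintype n] [DecidableEq n]
    (H : Matrix n n 𝕜) (hH : H.IsHermitian) :
    ConcaveOn ℝ {A : Matrix n n 𝕜 | A.PosDef} (fun A => liebTrace H A) := by
  refine ⟨fun A₁ h₁ A₂ h₂ a b ha hb hab => h₁.convexCombination h₂ ha hb hab,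
    fun A₁ h₁ A₂ h₂ a b ha hb hab => ?_⟩
  have hX₁ := (hH.add (isHermitian_matrixLog A₁)).posDef_exp
  have hX₂ := (hH.add (isHermitian_matrixLog A₂)).posDef_exp
  have h := gibbsFunctional_jointly_concave H hX₁ hX₂ h₁ h₂ ha hb hab
  rw [gibbsFunctional_exp hH, gibbsFunctional_exp hH] at h
  -- The combination of the two maximisers is a competitor at the combined `A`.
  exact h.trans (gibbsFunctional_le_liebTrace hH (hX₁.convexCombination hX₂ ha hb hab))
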